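/- Let $n \ge 2$, let $X \subseteq \mathbb{R}^n$ be open, let $U$ be a set, and let $G \colon X \times U \to X$ be such that for every $w \in U$ the map $G(\cdot,w)$ is a $C^{1,1}$-diffeomorphism of $X$ onto an open subset of $X$ (i.e. a $C^1$-diffeomorphism onto its open image whose derivative is locally Lipschitz). Let $\psi$ denote the general solution of $x_{k+1} = G(x_k,u_k)$, that is, $\psi(0,x,u) = x$ and $\psi(k+1,x,u) = G(\psi(k,x,u),u_k)$ for $k \in \mathbb{Z}_+$, $x \in X$ and $u \colon \mathbb{Z}_+ \to U$, and write $\psi(k,\Omega,u) = \{\psi(k,x,u) : x \in \Omega\}$. Let $N \ge 1$ be an integer, let $r > 0$, and let $\Omega \subseteq X$ be $r$-convex, i.e. $\Omega$ is an intersection of a family of closed Euclidean balls of radius $r$, with $\Omega \neq \mathbb{R}^n$. Denote by $D_1 G(x,w)$ the derivative of $G$ with respect to its first argument, by $\alpha_+(A)$ and $\alpha_-(A)$ the maximum and minimum singular values of $A$, and by $\|\cdot\|$ the Euclidean norm of vectors and the induced operator norm of linear maps. Assume that $L_1, L_2 \in \mathbb{R}$ satisfy $$L_1 \ge \frac{\alpha_+(D_1G(x,w))^2}{\alpha_-(D_1G(x,w))},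 \qquad L_2 \ge \limsup_{h \to 0,\, h \neq 0} \frac{\|D_1G(x,w)^{-1} D_1G(x+h,w) - \mathrm{id}\|}{\|h\|}$$ for all $w \in U$ and all $x \in \{\psi(k,p,u) : 0 \le k < N,\ p \in \Omega,\ u \colon \mathbb{Z}_+ \to U\}$. If $$r\, L_2 \sum_{\tau=0}^{N-1} L_1^{\tau} \le 1,$$ then the attainable set $\psi(k,\Omega,u)$ is convex for all $k \in \{0,1,\dots,N\}$ and all $u \colon \mathbb{Z}_+ \to U$. -/

import Mathlib

open Set Filter Topology

/-- `g` restricted to the open set `X` is a diffeomorphism of class `C^{1,1}` of `X` onto an open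
subset of `X`: it maps `X` into `X`, is injective on `X` with open image, is continuously
differentiable on `X` with locally Lipschitz derivative, and its inverse is continuously
differentiable on the image. (The inverse is then of class `C^{1,1}`, too.) Only the values of
`g` on `X` matter. -/
structure IsC11DiffeoInto {n : ℕ} (X : Set (EuclideanSpace ℝ (Fin n)))
    (g : EuclideanSpace ℝ (Fin n) → EuclideanSpace ℝ (Fin n)) : Prop where
  mapsTo : MapsTo g X X
  injOn : InjOn g X
  isOpen_image : IsOpen (g '' X)
  contDiffOn : ContDiffOn ℝ 1 g X
  locallyLipschitzOn_fderiv : LocallyLipschitzOn X (fderiv ℝ g)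
  contDiffOn_inverse : ∃ f : EuclideanSpace ℝ (Fin n) → EuclideanSpace ℝ (Fin n),
    LeftInvOn f g X ∧ ContDiffOn ℝ 1 f (g '' X)

/-- The general solution `ψ(k, x₀, u)` of the discrete-time system `x_{k+1} = G(x_k, u_k)`. -/
def generalSolution {n : ℕ} {U : Type*}
    (G : EuclideanSpace ℝ (Fin n) → U → EuclideanSpace ℝ (Fin n)) :
    ℕ → EuclideanSpace ℝ (Fin n) → (ℕ → U) → EuclideanSpace ℝ (Fin n)
  | 0, x, _ => x
  | k + 1, x, u => G (generalSolution G k x u) (u k)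

/-- The attainable set `ψ(k, Ω, u)`. -/
def attainableSet {n : ℕ} {U : Type*}
    (G : EuclideanSpace ℝ (Fin n) → U → EuclideanSpace ℝ (Fin n))
    (k : ℕ) (Ω : Set (EuclideanSpace ℝ (Fin n))) (u : ℕ → U) : Set (EuclideanSpace ℝ (Fin n)) :=
  (fun x => generalSolution G k x u) '' Ω

/-- The set `ψ([0;N[, Ω, U^{ℤ₊})` of states reachable from `Ω` at the times `0, …, N - 1`. -/
def reachableSet {n : ℕ} {U : Type*}
    (G : EuclideanSpace ℝ (Fin n) → U → EuclideanSpace ℝ (Fin n))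
    (N : ℕ) (Ω : Set (EuclideanSpace ℝ (Fin n))) : Set (EuclideanSpace ℝ (Fin n)) :=
  {x | ∃ k < N, ∃ u : ℕ → U, x ∈ attainableSet G k Ω u}

/-- `Ω` is `r`-convex (strongly convex of radius `r`): `r > 0` and `Ω` is an intersection of a
family of closed Euclidean balls of radius `r`. -/
def IsRConvex {n : ℕ} (r : ℝ) (Ω : Set (EuclideanSpace ℝ (Fin n))) : Prop :=
  0 < r ∧ ∃ M : Set (EuclideanSpace ℝ (Fin n)), Ω = ⋂ x ∈ M, Metric.closedBall x r

/-- The partial derivative `D₁G(x, w)`. -/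
noncomputable def D₁ {n : ℕ} {U : Type*}
    (G : EuclideanSpace ℝ (Fin n) → U → EuclideanSpace ℝ (Fin n))
    (x : EuclideanSpace ℝ (Fin n)) (w : U) :
    EuclideanSpace ℝ (Fin n) →L[ℝ] EuclideanSpace ℝ (Fin n) :=
  fderiv ℝ (fun y => G y w) x

/-- The maximum singular value of an endomorphism of `ℝⁿ`, `n ≥ 1`
(singular values are numbered `0, …, n - 1` in descending order). -/
noncomputable def maxSingularValue {n : ℕ}
    (A : EuclideanSpace ℝ (Fin n) →L[ℝ] EuclideanSpace ℝ (Fin n)) : ℝ :=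
  A.toLinearMap.singularValues 0

/-- The minimum singular value of an endomorphism of `ℝⁿ`, `n ≥ 1`. -/
noncomputable def minSingularValue {n : ℕ}
    (A : EuclideanSpace ℝ (Fin n) →L[ℝ] EuclideanSpace ℝ (Fin n)) : ℝ :=
  A.toLinearMap.singularValues (n - 1)

/-- The limes superior, for `h → 0`, `h ≠ 0`, of
`‖D₁G(x,w)⁻¹ D₁G(x+h,w) - id‖ / ‖h‖`, as an extended real number. -/
noncomputable def limsupQuotient {n : ℕ} {U : Type*}
    (G : EuclideanSpace ℝ (Fin n) → U → EuclideanSpace ℝ (Fin n))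
    (x : EuclideanSpace ℝ (Fin n)) (w : U) : EReal :=
  limsup (fun h : EuclideanSpace ℝ (Fin n) =>
    ((‖(D₁ G x w).inverse ∘L D₁ G (x + h) w -
        ContinuousLinearMap.id ℝ (EuclideanSpace ℝ (Fin n))‖ / ‖h‖ : ℝ) : EReal)) (𝓝[≠] 0)

/-! Call `C` a variation bound of `g` at `x` if `‖Dg(x)⁻¹ Dg(y) - id‖` is at most `C‖y - x‖` to
first order. The heart is that a map `g` with `r * C ≤ 1` sends an intersection of balls of radius
`r` to a convex set (`convex_image_iInter_closedBall`). For `s < r`, a boundary point `x` of the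
intersection `K` of the balls of radius `s` has a vector `v`, `‖v‖ ≤ s`, with `2⟪v, y - x⟫ ≤ -‖y -
x‖²` on `K`. Integrating the bound on `Dg` gives `⟪v, Dg(x)⁻¹(g y - g x)⟫ ≤ (s * c - 1)‖y - x‖² / 2
< 0` for `y ∈ K` near `x`, with `c` slightly above `C`. So the image is locally strictly supported;
a connectedness argument makes this global (`IsCompact.convex_image_interior_of_local_support`), and
`s → r` and a closure finish. For `g = ψ(k, ·, u)`, the chain rule turns bounds `C` of `g` and `D`
of `f` into `C + D‖A‖²‖A⁻¹‖` for `f ∘ g`, `A = Dg(x)`. Since `‖A‖²‖A⁻¹‖` is submultiplicative and at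
most `α₊² / α₋`, induction yields `L₂ ∑ L₁ ^ τ`. -/

/-! ### Singular values and operator norms. -/

section SingularValues

variable {E F : Type*} [NormedAddCommGroup E] [InnerProductSpace ℝ E] [FiniteDimensional ℝ E]
  [NormedAddCommGroup F] [InnerProductSpace ℝ F] [FiniteDimensional ℝ F]

/-- Expansion in an orthonormal eigenbasis of `T* T`, whose eigenvalues are the squared singular
values. -/
theorem LinearMap.norm_sq_apply_eq_sum_singularValues {n : ℕ} (T : E →ₗ[ℝ] F)
    (hn : Module.finrank ℝ E = n) (v : E) :
    ‖T v‖ ^ 2 = ∑ i : Fin n, T.singularValues i ^ 2 *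
      (T.isSymmetric_adjoint_comp_self.eigenvectorBasis hn).repr v i ^ 2 := by
  set b := T.isSymmetric_adjoint_comp_self.eigenvectorBasis hn with hb
  have h1 : ‖T v‖ ^ 2 = inner ℝ ((T.adjoint ∘ₗ T) v) v := by
    rw [LinearMap.comp_apply, LinearMap.adjoint_inner_left, real_inner_self_eq_norm_sq]
  rw [h1, ← b.repr.inner_map_map, PiLp.inner_apply]
  refine Finset.sum_congr rfl fun i _ => ?_
  rw [hb, T.isSymmetric_adjoint_comp_self.eigenvectorBasis_apply_self_apply hn v i,
    T.sq_singularValues_fin hn i]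
  simp
  ring

theorem LinearMap.norm_apply_le_singularValues_zero (T : E →ₗ[ℝ] F) (v : E) :
    ‖T v‖ ≤ T.singularValues 0 * ‖v‖ := by
  refine le_of_sq_le_sq ?_ (mul_nonneg (T.singularValues_nonneg 0) (norm_nonneg v))
  rw [T.norm_sq_apply_eq_sum_singularValues rfl v, mul_pow,
    ← (T.isSymmetric_adjoint_comp_self.eigenvectorBasis rfl).repr.norm_map v,
    EuclideanSpace.norm_sq_eq, Finset.mul_sum]
  refine Finset.sum_le_sum fun i _ => ?_
  rw [Real.norm_eq_abs, sq_abs]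
  gcongr
  · exact T.singularValues_nonneg _
  · exact T.singularValues_antitone (Nat.zero_le _)

theorem LinearMap.singularValues_last_mul_norm_le {n : ℕ} (T : E →ₗ[ℝ] F)
    (hn : Module.finrank ℝ E = n) (v : E) :
    T.singularValues (n - 1) * ‖v‖ ≤ ‖T v‖ := by
  refine le_of_sq_le_sq ?_ (norm_nonneg _)
  rw [T.norm_sq_apply_eq_sum_singularValues hn v, mul_pow,
    ← (T.isSymmetric_adjoint_comp_self.eigenvectorBasis hn).repr.norm_map v,
    EuclideanSpace.norm_sq_eq, Finset.mul_sum]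
  refine Finset.sum_le_sum fun i _ => ?_
  rw [Real.norm_eq_abs, sq_abs]
  gcongr
  · exact T.singularValues_nonneg _
  · exact T.singularValues_antitone (by omega)

end SingularValues

theorem norm_sq_mul_norm_inverse_le {n : ℕ} (hn : 1 ≤ n)
    {A : EuclideanSpace ℝ (Fin n) →L[ℝ] EuclideanSpace ℝ (Fin n)} (hA : A.IsInvertible) :
    ‖A‖ ^ 2 * ‖A.inverse‖ ≤ maxSingularValue A ^ 2 / minSingularValue A := by
  have hmax : ‖A‖ ≤ maxSingularValue A :=
    A.opNorm_le_bound (A.toLinearMap.singularValues_nonneg 0)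
      A.toLinearMap.norm_apply_le_singularValues_zero
  have hlow := A.toLinearMap.singularValues_last_mul_norm_le (n := n) (by simp)
  have hpos : 0 < minSingularValue A := by
    have hinj : Function.Injective A.toLinearMap := by
      obtain ⟨e, rfl⟩ := hA
      exact e.injective
    exact A.toLinearMap.injective_iff_forall_lt_finrank_singularValues_pos.1 hinj _
      (by simp; omega)
  have hinv : ‖A.inverse‖ ≤ (minSingularValue A)⁻¹ := by
    refine A.inverse.opNorm_le_bound (inv_nonneg.2 hpos.le) fun v => ?_
    rw [inv_mul_eq_div, le_div_iff₀ hpos, mul_comm]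
    refine (hlow _).trans_eq ?_
    exact congrArg norm (hA.self_apply_inverse v)
  rw [div_eq_mul_inv]
  gcongr

/-! ### From local support to convexity. -/

/-- For fixed `a`, the points `b` whose image segment from `g a` stays in `g '' interior K` form a
set that is open and relatively closed in the connected set `interior K`. A limit segment lies in `g
'' K`, and strict local support prevents it from touching the image of the frontier. -/
theorem IsCompact.convex_image_interior_of_local_support {E : Type*} [NormedAddCommGroup E]
    [NormedSpace ℝ E] {X K : Set E} {g : E → E} (hK : IsCompact K) (hconv : Convex ℝ K)
    (hX : IsOpen X) (hKX : K ⊆ X) (hinj : InjOn g X)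
    (hmap : ∀ x ∈ K, map g (𝓝 x) = 𝓝 (g x))
    (hsupp : ∀ x ∈ frontier K, ∃ l : E →L[ℝ] ℝ,
      ∀ᶠ y in 𝓝 x, y ∈ K → y ≠ x → l (g y) < l (g x)) :
    Convex ℝ (g '' interior K) := by
  have hcont : ContinuousOn g K := fun x hx =>
    (show ContinuousAt g x from (hmap x hx).le).continuousWithinAt
  have hopen : IsOpen (g '' interior K) := by
    rw [isOpen_iff_mem_nhds]
    rintro _ ⟨x, hx, rfl⟩
    rw [← hmap x (interior_subset hx)]
    exact image_mem_map (isOpen_interior.mem_nhds hx)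
  have hclosed : IsClosed (g '' K) := (hK.image_of_continuousOn hcont).isClosed
  have key : ∀ a ∈ interior K, ∀ b ∈ interior K,
      (∀ t ∈ Icc (0 : ℝ) 1, AffineMap.lineMap (g a) (g b) t ∈ g '' K) →
      ∀ t ∈ Icc (0 : ℝ) 1, AffineMap.lineMap (g a) (g b) t ∈ g '' interior K := by
    intro a ha b hb h t ht
    rcases ht.1.eq_or_lt with rfl | ht0
    · simpa using mem_image_of_mem g ha
    rcases ht.2.eq_or_lt with rfl | ht1
    · simpa using mem_image_of_mem g hb
    by_cases hab : g a = g b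
    · simpa [hab] using mem_image_of_mem g hb
    obtain ⟨x, hx, hxt⟩ := h t ht
    rw [← hxt]
    refine mem_image_of_mem g (by_contra fun hxi => ?_)
    obtain ⟨l, hl⟩ := hsupp x (by rw [hK.isClosed.frontier_eq]; exact ⟨hx, hxi⟩)
    -- `g` is open at `x`, so nearby points of the segment have preimages near `x`; injectivity on
    -- `X` identifies these with their preimages in `K`.
    have hV : g '' ({y | y ∈ K → y ≠ x → l (g y) < l (g x)} ∩ X) ∈
        𝓝 (AffineMap.lineMap (g a) (g b) t) := by
      rw [← hxt, ← hmap x hx]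
      exact image_mem_map (inter_mem hl (hX.mem_nhds (hKX hx)))
    have hline : ∀ᶠ s in 𝓝 t, s ∈ Icc (0 : ℝ) 1 ∧
        (s ≠ t → l (AffineMap.lineMap (g a) (g b) s) < l (g x)) := by
      have hc : ContinuousAt (fun s : ℝ => AffineMap.lineMap (g a) (g b) s) t :=
        (AffineMap.lineMap_continuous).continuousAt
      filter_upwards [Icc_mem_nhds ht0 ht1, hc.preimage_mem_nhds hV] with s hs hsV
      refine ⟨hs, fun hst => ?_⟩
      obtain ⟨y, ⟨hy, hyX⟩, hys⟩ := hsV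
      obtain ⟨z, hz, hzs⟩ := h s hs
      have hyz : y = z := hinj hyX (hKX hz) (hys.trans hzs.symm)
      subst hyz
      simp only at hys
      rw [← hys]
      refine hy hz ?_
      rintro rfl
      exact hst (AffineMap.lineMap_injective ℝ hab (hzs.symm.trans hxt))
    obtain ⟨ε, hε, hball⟩ := Metric.eventually_nhds_iff.1 hline
    -- An affine function of the segment parameter cannot have a strict local maximum at the
    -- interior point `t`.
    have h1 := (@hball (t + ε / 2) (by simp [abs_of_pos hε]; linarith)).2 (by linarith)
    have h2 := (@hball (t - ε / 2) (by simp [abs_of_pos hε]; linarith)).2 (by linarith)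
    rw [hxt] at h1 h2
    simp only [AffineMap.lineMap_apply, vsub_eq_sub, vadd_eq_add, map_add, map_smul, map_sub,
      smul_eq_mul] at h1 h2
    nlinarith
  rw [convex_iff_segment_subset]
  rintro _ ⟨a, ha, rfl⟩ _ ⟨b, hb, rfl⟩
  set u : Set E := {b | b ∈ interior K ∧
    ∀ t ∈ Icc (0 : ℝ) 1, AffineMap.lineMap (g a) (g b) t ∈ g '' interior K} with hu
  have hgi : ∀ b ∈ interior K, ContinuousAt g b := fun b hb =>
    hcont.continuousAt (mem_interior_iff_mem_nhds.1 hb)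
  have huo : IsOpen u := by
    rw [isOpen_iff_mem_nhds]
    rintro c ⟨hc, hct⟩
    refine inter_mem (isOpen_interior.mem_nhds hc) ?_
    -- Tube lemma: compactness of `[0, 1]` makes the neighbourhood of `c` uniform in `t`.
    refine isCompact_Icc.eventually_forall_of_forall_eventually fun t ht => ?_
    have hcc : ContinuousAt
        (fun z : E × ℝ => (AffineMap.lineMap (g a) (g z.1) z.2 : E)) (c, t) := by
      have := hgi c hc
      simp only [AffineMap.lineMap_apply, vsub_eq_sub, vadd_eq_add]
      have h1 : ContinuousAt (fun z : E × ℝ => g z.1) (c, t) :=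
        ContinuousAt.comp (x := (c, t)) (g := g) this continuousAt_fst
      fun_prop
    exact hcc.eventually (hopen.mem_nhds (hct t ht))
  have hsub : interior K ⊆ u := by
    refine hconv.interior.isPreconnected.subset_of_closure_inter_subset huo
      ⟨a, ha, ha, fun t _ => by simpa using mem_image_of_mem g ha⟩ ?_
    rintro c ⟨hcu, hc⟩
    refine ⟨hc, key a ha c hc fun t ht => ?_⟩
    have hcc : ContinuousAt (fun z : E => (AffineMap.lineMap (g a) (g z) t : E)) c := by
      have := hgi c hc
      simp only [AffineMap.lineMap_apply, vsub_eq_sub, vadd_eq_add]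
      fun_prop
    rw [← hclosed.closure_eq]
    refine closure_mono ?_ (mem_closure_image (f := fun z : E => (AffineMap.lineMap (g a) (g z) t : E))
      hcc hcu)
    rintro _ ⟨z, hz, rfl⟩
    exact image_mono interior_subset (hz.2 t ht)
  rw [segment_eq_image_lineMap]
  rintro _ ⟨t, ht, rfl⟩
  exact (hsub hb).2 t ht

/-! ### Normals to intersections of balls. -/

theorem exists_normal_of_mem_frontier_iInter_closedBall {E : Type*} [NormedAddCommGroup E]
    [InnerProductSpace ℝ E] [ProperSpace E] {M : Set E} (hM : M.Nonempty) {s : ℝ} {x : E}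
    (hx : x ∈ frontier (⋂ m ∈ M, Metric.closedBall m s)) :
    ∃ v : E, ‖v‖ ≤ s ∧ ∀ y ∈ ⋂ m ∈ M, Metric.closedBall m s,
      2 * inner ℝ v (y - x) ≤ -‖y - x‖ ^ 2 := by
  set K := ⋂ m ∈ M, Metric.closedBall m s with hKdef
  have hKc : IsClosed K := isClosed_biInter fun m _ => Metric.isClosed_closedBall
  have hxK : x ∈ K := hKc.frontier_subset hx
  have hxi : x ∉ interior K := by
    rw [hKc.frontier_eq] at hx
    exact hx.2
  -- `M` need not be closed, so the largest distance from `x` may not be attained on it. The set `C`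
  -- of all centres whose `s`-ball contains `K` is compact and contains `M`.
  set C : Set E := ⋂ y ∈ K, Metric.closedBall y s with hC
  have hCx : ∀ m ∈ C, dist x m ≤ s := fun m hm => by
    have := mem_iInter₂.1 hm x hxK
    rwa [Metric.mem_closedBall, dist_comm] at this
  have hMC : M ⊆ C := fun m hm => mem_iInter₂.2 fun y hy => by
    have := mem_iInter₂.1 hy m hm
    rwa [Metric.mem_closedBall, dist_comm] at this
  have hCcomp : IsCompact C := (isCompact_closedBall x s).of_isClosed_subset
    (isClosed_biInter fun m _ => Metric.isClosed_closedBall) fun m hm => mem_iInter₂.1 hm x hxK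
  obtain ⟨m, hm, hmax⟩ := hCcomp.exists_isMaxOn (hM.mono hMC)
    (f := fun m => dist x m) (by fun_prop)
  -- If every centre were closer than `s` by a uniform margin, `x` would be interior to `K`.
  have hms : dist x m = s := by
    refine (hCx m hm).antisymm (not_lt.1 fun hlt => hxi ?_)
    rw [mem_interior_iff_mem_nhds]
    filter_upwards [Metric.ball_mem_nhds x (sub_pos.2 hlt)] with y hy
    refine mem_iInter₂.2 fun c hc => ?_
    have h1 : dist x c ≤ dist x m := hmax (hMC hc)
    have h2 := dist_triangle y x c
    rw [Metric.mem_ball] at hy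
    rw [Metric.mem_closedBall]
    linarith
  refine ⟨x - m, by rw [← dist_eq_norm, hms], fun y hy => ?_⟩
  have h1 : ‖y - m‖ ≤ ‖x - m‖ := by
    rw [← dist_eq_norm, ← dist_eq_norm, hms, dist_comm]
    exact mem_iInter₂.1 hm y hy
  have h2 := norm_add_sq_real (x - m) (y - x)
  rw [show x - m + (y - x) = y - m by abel] at h2
  have h3 := pow_le_pow_left₀ (norm_nonneg _) h1 2
  linarith

/-! ### Relative variation of the derivative. -/

section DerivVariation

variable {E : Type*} [NormedAddCommGroup E] [NormedSpace ℝ E]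

/-- Near `x`, `‖Dg(x)⁻¹ Dg(y) - id‖ ≤ c * ‖y - x‖` for every constant `c > C`. -/
def DerivVariationLE (g : E → E) (x : E) (C : ℝ) : Prop :=
  ∀ c > C, ∀ᶠ y in 𝓝 x,
    ‖(fderiv ℝ g x).inverse ∘L fderiv ℝ g y - ContinuousLinearMap.id ℝ E‖ ≤ c * ‖y - x‖

theorem DerivVariationLE.mono {g : E → E} {x : E} {C D : ℝ} (h : DerivVariationLE g x C)
    (hCD : C ≤ D) : DerivVariationLE g x D := fun c hc => h c (hCD.trans_lt hc)

theorem derivVariationLE_id (x : E) : DerivVariationLE (fun y : E => y) x 0 := by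
  intro c hc
  filter_upwards with y
  have : (fderiv ℝ (fun y : E => y) x).inverse ∘L fderiv ℝ (fun y : E => y) y
      - ContinuousLinearMap.id ℝ E = 0 := by
    simp
  rw [this, norm_zero]
  exact mul_nonneg hc.le (norm_nonneg _)

/-- One factor `‖A‖` bounds the local stretching of `g`; the other, with `‖A⁻¹‖`, comes from
conjugating the variation of `f` by `A`. -/
theorem DerivVariationLE.comp {f g : E → E} {x : E} {C D : ℝ} (hC : 0 ≤ C) (hD : 0 ≤ D)
    (hg : DerivVariationLE g x C) (hf : DerivVariationLE f (g x) D)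
    (hgd : ∀ᶠ y in 𝓝 x, DifferentiableAt ℝ g y)
    (hfd : ∀ᶠ z in 𝓝 (g x), DifferentiableAt ℝ f z)
    (hgi : (fderiv ℝ g x).IsInvertible) (hfi : (fderiv ℝ f (g x)).IsInvertible) :
    DerivVariationLE (fun y => f (g y)) x
      (C + D * (‖fderiv ℝ g x‖ ^ 2 * ‖(fderiv ℝ g x).inverse‖)) := by
  intro c hc
  have hcont : ContinuousAt g x := hgd.self_of_nhds.continuousAt
  have hfderiv : ∀ y, DifferentiableAt ℝ g y → DifferentiableAt ℝ f (g y) →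
      fderiv ℝ (fun y => f (g y)) y = fderiv ℝ f (g y) ∘L fderiv ℝ g y :=
    fun y h1 h2 => fderiv_fun_comp y h2 h1
  rw [hfderiv x hgd.self_of_nhds hfd.self_of_nhds, hfi.inverse_comp_of_left]
  set A := fderiv ℝ g x with hA
  set B := fderiv ℝ f (g x) with hB
  -- At `ε = 0` the left side is the claimed constant, which is below `c`; continuity leaves room
  -- for a positive `ε`.
  obtain ⟨ε, hεc, hε⟩ : ∃ ε : ℝ, ‖A.inverse‖ * ((D + ε) * (‖A‖ + ε) * ‖A‖) *
      (1 + (C + ε) * ε) + (C + ε) < c ∧ 0 < ε := by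
    have hlim : ContinuousAt (fun ε : ℝ => ‖A.inverse‖ * ((D + ε) * (‖A‖ + ε) * ‖A‖) *
      (1 + (C + ε) * ε) + (C + ε)) 0 := by fun_prop
    have := hlim.eventually_lt_const (u := c) (by
      refine lt_of_eq_of_lt ?_ hc
      ring)
    exact ((this.filter_mono nhdsWithin_le_nhds).and
      (self_mem_nhdsWithin : Ioi (0 : ℝ) ∈ 𝓝[>] 0)).exists
  have hlip : ∀ᶠ y in 𝓝 x, ‖g y - g x‖ ≤ (‖A‖ + ε) * ‖y - x‖ := by
    filter_upwards [hgd.self_of_nhds.hasFDerivAt.isLittleO.def hε] with y hy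
    have h1 := A.le_opNorm (y - x)
    have h2 := norm_add_le (g y - g x - A (y - x)) (A (y - x))
    rw [sub_add_cancel] at h2
    linarith
  filter_upwards [hgd, hcont.eventually hfd, hg (C + ε) (by linarith),
    hcont.eventually (hf (D + ε) (by linarith)), hlip, Metric.ball_mem_nhds x hε]
    with y hy1 hy2 hy3 hy4 hy5 hy6
  rw [hfderiv y hy1 hy2]
  rw [Metric.mem_ball, dist_eq_norm] at hy6
  set P := A.inverse ∘L fderiv ℝ g y - ContinuousLinearMap.id ℝ E with hP
  set Q := B.inverse ∘L fderiv ℝ f (g y) - ContinuousLinearMap.id ℝ E with hQ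
  have hAA : ∀ v, A (A.inverse v) = v := fun v => hgi.self_apply_inverse v
  have hid : (A.inverse ∘L B.inverse) ∘L fderiv ℝ f (g y) ∘L fderiv ℝ g y -
      ContinuousLinearMap.id ℝ E =
      (A.inverse ∘L Q ∘L A) ∘L (ContinuousLinearMap.id ℝ E + P) + P := by
    ext v
    simp [hP, hQ, hAA]
  rw [hid]
  have hPε : ‖P‖ ≤ (C + ε) * ε := hy3.trans (by gcongr)
  have hQ' : ‖Q‖ ≤ (D + ε) * ((‖A‖ + ε) * ‖y - x‖) := hy4.trans (by gcongr)
  calc ‖(A.inverse ∘L Q ∘L A) ∘L (ContinuousLinearMap.id ℝ E + P) + P‖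
      ≤ ‖(A.inverse ∘L Q ∘L A) ∘L (ContinuousLinearMap.id ℝ E + P)‖ + ‖P‖ := norm_add_le _ _
    _ ≤ ‖A.inverse‖ * (‖Q‖ * ‖A‖) * (1 + ‖P‖) + ‖P‖ := by
        gcongr
        refine (ContinuousLinearMap.opNorm_comp_le _ _).trans ?_
        gcongr
        · refine (ContinuousLinearMap.opNorm_comp_le _ _).trans ?_
          gcongr
          exact ContinuousLinearMap.opNorm_comp_le _ _
        · refine (norm_add_le _ _).trans ?_
          gcongr
          exact ContinuousLinearMap.norm_id_le
    _ ≤ ‖A.inverse‖ * ((D + ε) * ((‖A‖ + ε) * ‖y - x‖) * ‖A‖) * (1 + (C + ε) * ε) +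
        (C + ε) * ‖y - x‖ := by gcongr
    _ = (‖A.inverse‖ * ((D + ε) * (‖A‖ + ε) * ‖A‖) * (1 + (C + ε) * ε) + (C + ε)) *
        ‖y - x‖ := by ring
    _ ≤ c * ‖y - x‖ := by gcongr

/-- The functional is `⟪v, Dg(x)⁻¹ ·⟫`: pulled back by `g`, it has derivative `⟪v, ·⟫` at `x` when
`Dg(x)` is invertible. -/
theorem DerivVariationLE.exists_local_support {E : Type*} [NormedAddCommGroup E]
    [InnerProductSpace ℝ E] {g : E → E} {x v : E} {C s : ℝ} {K : Set E}
    (hg : DerivVariationLE g x C) (hs : 0 ≤ s) (hsC : s * C < 1)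
    (hgd : ∀ᶠ y in 𝓝 x, DifferentiableAt ℝ g y)
    (hv : ‖v‖ ≤ s) (hK : ∀ y ∈ K, 2 * inner ℝ v (y - x) ≤ -‖y - x‖ ^ 2) :
    ∃ l : E →L[ℝ] ℝ, ∀ᶠ y in 𝓝 x, y ∈ K → y ≠ x → l (g y) < l (g x) := by
  set A := fderiv ℝ g x with hA
  obtain ⟨c, hcC, hsc⟩ : ∃ c > C, s * c < 1 := by
    have hlim : ContinuousAt (fun c : ℝ => s * c) C := by fun_prop
    have := hlim.eventually_lt_const (u := 1) hsC
    obtain ⟨c, h1, h2⟩ := ((this.filter_mono nhdsWithin_le_nhds).and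
      (self_mem_nhdsWithin : Ioi C ∈ 𝓝[>] C)).exists
    exact ⟨c, h2, h1⟩
  set l : E →L[ℝ] ℝ := innerSL ℝ v ∘L A.inverse with hl
  refine ⟨l, ?_⟩
  obtain ⟨δ, hδ, hball⟩ := Metric.eventually_nhds_iff_ball.1 ((hg c hcC).and hgd)
  filter_upwards [Metric.ball_mem_nhds x hδ] with y hy hyK hyx
  set h := y - x with hh
  have hpos : 0 < ‖h‖ := norm_pos_iff.2 (sub_ne_zero.2 hyx)
  have hmem : ∀ t ∈ Icc (0 : ℝ) 1, x + t • h ∈ Metric.ball x δ := fun t ht => by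
    rw [Metric.mem_ball, dist_eq_norm, add_sub_cancel_left, norm_smul, Real.norm_eq_abs,
      abs_of_nonneg ht.1]
    rw [Metric.mem_ball, dist_eq_norm] at hy
    nlinarith [ht.2, norm_nonneg h]
  -- The variation bound at `x + t • h` is proportional to `t`; integrating it gives the factor `1 /
  -- 2` that matches the `2` in `hK`.
  have hderiv : ∀ t ∈ Icc (0 : ℝ) 1, HasDerivAt
      (fun t : ℝ => l (g (x + t • h)) - t * inner ℝ v h - s * c * ‖h‖ ^ 2 / 2 * t ^ 2)
      (l (fderiv ℝ g (x + t • h) h) - inner ℝ v h - s * c * ‖h‖ ^ 2 * t) t := by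
    intro t ht
    have h1 : HasDerivAt (fun t : ℝ => x + t • h) h t := by
      simpa using ((hasDerivAt_id t).smul_const h).const_add x
    have h2 := ((hball _ (hmem t ht)).2.hasFDerivAt).comp_hasDerivAt t h1
    have h3 := l.hasFDerivAt.comp_hasDerivAt t h2
    have h4 := (hasDerivAt_id t).mul_const (inner ℝ v h)
    have h5 := ((hasDerivAt_id t).pow 2).const_mul (s * c * ‖h‖ ^ 2 / 2)
    refine ((h3.sub h4).sub h5).congr_deriv ?_
    simp
    ring
  have hanti : AntitoneOn
      (fun t : ℝ => l (g (x + t • h)) - t * inner ℝ v h - s * c * ‖h‖ ^ 2 / 2 * t ^ 2)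
      (Icc 0 1) := by
    refine antitoneOn_of_deriv_nonpos (convex_Icc 0 1)
      (fun t ht => (hderiv t ht).continuousAt.continuousWithinAt)
      (fun t ht => (hderiv t (interior_subset ht)).differentiableAt.differentiableWithinAt)
      fun t ht => ?_
    have ht := interior_subset ht
    rw [(hderiv t ht).deriv]
    have h1 := (hball _ (hmem t ht)).1
    rw [add_sub_cancel_left, norm_smul, Real.norm_eq_abs, abs_of_nonneg ht.1] at h1
    have h2 : l (fderiv ℝ g (x + t • h) h) - inner ℝ v h = inner ℝ v
        ((A.inverse ∘L fderiv ℝ g (x + t • h) - ContinuousLinearMap.id ℝ E) h) := by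
      simp [hl, inner_sub_right]
    have h3 := real_inner_le_norm v
        ((A.inverse ∘L fderiv ℝ g (x + t • h) - ContinuousLinearMap.id ℝ E) h)
    have h4 : ‖v‖ * ‖(A.inverse ∘L fderiv ℝ g (x + t • h) - ContinuousLinearMap.id ℝ E) h‖ ≤
        s * (c * (t * ‖h‖) * ‖h‖) := by
      gcongr
      exact ContinuousLinearMap.le_of_opNorm_le _ h1 h
    rw [h2]
    nlinarith
  have h01 := hanti (left_mem_Icc.2 zero_le_one) (right_mem_Icc.2 zero_le_one) zero_le_one
  have hxy : x + h = y := by rw [hh]; abel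
  simp only [one_smul, zero_smul, add_zero, hxy] at h01
  have := hK y hyK
  nlinarith [pow_pos hpos 2]

end DerivVariation

/-! ### Convex images of intersections of balls. -/

/-- By the parallelogram law, the midpoint of two points `a`, `b` has squared distance at most `r² -
‖a - b‖² / 4` from every centre. The choice of `ε` makes this at most `(r - ε)²`. -/
theorem interior_nonempty_iInter_closedBall {E : Type*} [NormedAddCommGroup E]
    [InnerProductSpace ℝ E] {M : Set E} {r : ℝ} (hr : 0 < r)
    (h : (⋂ m ∈ M, Metric.closedBall m r).Nontrivial) :
    (interior (⋂ m ∈ M, Metric.closedBall m r)).Nonempty := by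
  obtain ⟨a, ha, b, hb, hab⟩ := h
  have hd : 0 < ‖a - b‖ := norm_pos_iff.2 (sub_ne_zero.2 hab)
  set ε := ‖a - b‖ ^ 2 / (8 * r) with hε
  have hεr : ε * (8 * r) = ‖a - b‖ ^ 2 := by rw [hε]; field_simp
  have hε0 : 0 < ε := by positivity
  refine ⟨(2⁻¹ : ℝ) • (a + b), mem_interior_iff_mem_nhds.2 ?_⟩
  filter_upwards [Metric.ball_mem_nhds _ hε0] with y hy
  refine mem_iInter₂.2 fun m hm => ?_
  have ha' := mem_iInter₂.1 ha m hm
  have hb' := mem_iInter₂.1 hb m hm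
  rw [Metric.mem_closedBall, dist_eq_norm] at ha' hb'
  have hpar := parallelogram_law_with_norm ℝ (a - m) (b - m)
  rw [sub_sub_sub_cancel_right] at hpar
  have hmid : a - m + (b - m) = (2 : ℝ) • ((2⁻¹ : ℝ) • (a + b) - m) := by module
  rw [hmid, norm_smul, Real.norm_eq_abs, abs_two] at hpar
  set q := ‖(2⁻¹ : ℝ) • (a + b) - m‖ with hq
  have hq0 : 0 ≤ q := norm_nonneg _
  have hqr : q ^ 2 ≤ r ^ 2 - 2 * r * ε := by
    nlinarith [norm_nonneg (a - m), norm_nonneg (b - m)]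
  have hqε : q ≤ r - ε := by
    have : ε ≤ r := by nlinarith
    nlinarith
  rw [Metric.mem_ball] at hy
  have h2 := dist_triangle y ((2⁻¹ : ℝ) • (a + b)) m
  rw [dist_eq_norm ((2⁻¹ : ℝ) • (a + b)) m, ← hq] at h2
  rw [Metric.mem_closedBall]
  linarith

theorem exists_mem_interior_iInter_closedBall_smaller {E : Type*} [NormedAddCommGroup E]
    [NormedSpace ℝ E] [Nontrivial E] {M : Set E} {r : ℝ} (hr : 0 < r) {a : E}
    (ha : a ∈ interior (⋂ m ∈ M, Metric.closedBall m r)) :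
    ∃ s, 0 < s ∧ s < r ∧ a ∈ interior (⋂ m ∈ M, Metric.closedBall m s) := by
  obtain ⟨ε, hε, hball⟩ := Metric.mem_nhds_iff.1 (mem_interior_iff_mem_nhds.1 ha)
  set η := min (ε / 4) (r / 4) with hη
  have hη0 : 0 < η := by positivity
  have hηε : η ≤ ε / 4 := min_le_left _ _
  have hηr : η ≤ r / 4 := min_le_right _ _
  refine ⟨r - η, by linarith, by linarith, mem_interior_iff_mem_nhds.2 ?_⟩
  filter_upwards [Metric.ball_mem_nhds a hη0] with y hy
  refine mem_iInter₂.2 fun m hm => ?_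
  -- Push `y` by `η` straight away from `m`. The result is still in the ball around `a`, hence
  -- within `r` of `m`, so `y` is within `r - η`.
  obtain ⟨w, hw, hwy⟩ : ∃ w : E, ‖w‖ = η ∧ ‖y - m + w‖ = ‖y - m‖ + η := by
    by_cases hym : y - m = 0
    · obtain ⟨w, hw⟩ := exists_norm_eq E hη0.le
      exact ⟨w, hw, by simp [hym, hw]⟩
    · have hpos : 0 < ‖y - m‖ := norm_pos_iff.2 hym
      refine ⟨(η / ‖y - m‖) • (y - m), ?_, ?_⟩
      · rw [norm_smul, Real.norm_of_nonneg (by positivity)]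
        field_simp
      · have : y - m + (η / ‖y - m‖) • (y - m) = (1 + η / ‖y - m‖) • (y - m) := by module
        rw [this, norm_smul, Real.norm_of_nonneg (by positivity)]
        field_simp
  have hyw : y + w ∈ Metric.ball a ε := by
    rw [Metric.mem_ball, dist_eq_norm] at hy ⊢
    have := norm_add_le (y - a) w
    rw [show y + w - a = y - a + w by abel]
    linarith
  have h1 := mem_iInter₂.1 (hball hyw) m hm
  rw [Metric.mem_closedBall, dist_eq_norm, show y + w - m = y - m + w by abel, hwy] at h1
  rw [Metric.mem_closedBall, dist_eq_norm]
  linarith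

/-- Strict support needs `s * C < 1`, hence radii `s < r`. The interiors for such `s` exhaust the
interior for `r`, and unless the intersection has at most one point, it is the closure of its
interior. -/
theorem convex_image_iInter_closedBall {E : Type*} [NormedAddCommGroup E]
    [InnerProductSpace ℝ E] [FiniteDimensional ℝ E] [Nontrivial E] {X M : Set E} {g : E → E}
    {r C : ℝ} (hr : 0 < r) (hC : 0 ≤ C) (hrC : r * C ≤ 1) (hM : M.Nonempty) (hX : IsOpen X)
    (hMX : ⋂ m ∈ M, Metric.closedBall m r ⊆ X) (hinj : InjOn g X) (hg : ContDiffOn ℝ 1 g X)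
    (hinv : ∀ x ∈ X, (fderiv ℝ g x).IsInvertible)
    (hvar : ∀ x ∈ ⋂ m ∈ M, Metric.closedBall m r, DerivVariationLE g x C) :
    Convex ℝ (g '' ⋂ m ∈ M, Metric.closedBall m r) := by
  have : ProperSpace E := FiniteDimensional.proper_real E
  have : CompleteSpace E := FiniteDimensional.complete ℝ E
  have hcompact : ∀ s, IsCompact (⋂ m ∈ M, Metric.closedBall m s) := fun s => by
    obtain ⟨m, hm⟩ := hM
    exact (isCompact_closedBall m s).of_isClosed_subset
      (isClosed_biInter fun m _ => Metric.isClosed_closedBall) (biInter_subset_of_mem hm)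
  have hconv : ∀ s, Convex ℝ (⋂ m ∈ M, Metric.closedBall m s) := fun s =>
    convex_iInter₂ fun m _ => convex_closedBall m s
  have hmono : ∀ {s t : ℝ}, s ≤ t →
      ⋂ m ∈ M, Metric.closedBall m s ⊆ ⋂ m ∈ M, Metric.closedBall m t := fun h =>
    iInter₂_mono fun m _ => Metric.closedBall_subset_closedBall h
  have hcda : ∀ x ∈ X, ContDiffAt ℝ 1 g x := fun x hx => hg.contDiffAt (hX.mem_nhds hx)
  have hmap : ∀ x ∈ X, map g (𝓝 x) = 𝓝 (g x) := fun x hx => by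
    obtain ⟨e, he⟩ := hinv x hx
    have := (hcda x hx).hasStrictFDerivAt one_ne_zero
    rw [← he] at this
    exact this.map_nhds_eq_of_equiv
  have hstep : ∀ s, 0 < s → s < r →
      Convex ℝ (g '' interior (⋂ m ∈ M, Metric.closedBall m s)) := by
    intro s hs hsr
    have hsub := (hmono hsr.le).trans hMX
    refine (hcompact s).convex_image_interior_of_local_support (hconv s) hX hsub hinj
      (fun x hx => hmap x (hsub hx)) fun x hx => ?_
    have hxs := (hcompact s).isClosed.frontier_subset hx
    obtain ⟨v, hv, hvK⟩ := exists_normal_of_mem_frontier_iInter_closedBall hM hx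
    refine (hvar x (hmono hsr.le hxs)).exists_local_support hs.le ?_ ?_ hv hvK
    · rcases hC.eq_or_lt with rfl | hC
      · simp
      · nlinarith
    · filter_upwards [hX.mem_nhds (hsub hxs)] with y hy
      exact (hcda y hy).differentiableAt one_ne_zero
  have hcont : ContinuousOn g (⋂ m ∈ M, Metric.closedBall m r) := hg.continuousOn.mono hMX
  by_cases hsing : (⋂ m ∈ M, Metric.closedBall m r).Subsingleton
  · exact (hsing.image g).convex
  have hint : Convex ℝ (g '' interior (⋂ m ∈ M, Metric.closedBall m r)) := by
    rw [convex_iff_segment_subset]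
    rintro _ ⟨a, ha, rfl⟩ _ ⟨b, hb, rfl⟩
    obtain ⟨s, hs, hsr, has⟩ := exists_mem_interior_iInter_closedBall_smaller hr ha
    obtain ⟨t, ht, htr, hbt⟩ := exists_mem_interior_iInter_closedBall_smaller hr hb
    refine ((hstep (max s t) (lt_max_of_lt_left hs) (max_lt hsr htr)).segment_subset
      (mem_image_of_mem g (interior_mono (hmono (le_max_left s t)) has))
      (mem_image_of_mem g (interior_mono (hmono (le_max_right s t)) hbt))).trans
      (image_mono (interior_mono (hmono (max_lt hsr htr).le)))
  have hclos : closure (interior (⋂ m ∈ M, Metric.closedBall m r)) =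
      ⋂ m ∈ M, Metric.closedBall m r := by
    rw [(hconv r).closure_interior_eq_closure_of_nonempty_interior
      (interior_nonempty_iInter_closedBall hr (not_subsingleton_iff.1 hsing)),
      (hcompact r).isClosed.closure_eq]
  have heq : closure (g '' interior (⋂ m ∈ M, Metric.closedBall m r)) =
      g '' ⋂ m ∈ M, Metric.closedBall m r := by
    refine (closure_minimal (image_mono interior_subset)
      ((hcompact r).image_of_continuousOn hcont).isClosed).antisymm ?_
    have := ContinuousOn.image_closure (f := g)
      (s := interior (⋂ m ∈ M, Metric.closedBall m r)) (by rwa [hclos])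
    rwa [hclos] at this
  rw [← heq]
  exact hint.closure

/-! ### Iterates of the system. -/

section

variable {n : ℕ} {X : Set (EuclideanSpace ℝ (Fin n))}
  {g : EuclideanSpace ℝ (Fin n) → EuclideanSpace ℝ (Fin n)}

theorem IsC11DiffeoInto.isInvertible_fderiv (hg : IsC11DiffeoInto X g) (hX : IsOpen X)
    {x : EuclideanSpace ℝ (Fin n)} (hx : x ∈ X) : (fderiv ℝ g x).IsInvertible := by
  obtain ⟨f, hfg, hf⟩ := hg.contDiffOn_inverse
  have h1 : DifferentiableAt ℝ g x :=
    (hg.contDiffOn.contDiffAt (hX.mem_nhds hx)).differentiableAt one_ne_zero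
  have h2 : DifferentiableAt ℝ f (g x) :=
    (hf.contDiffAt (hg.isOpen_image.mem_nhds (mem_image_of_mem g hx))).differentiableAt
      one_ne_zero
  have h3 : (fderiv ℝ f (g x)) ∘L (fderiv ℝ g x) = ContinuousLinearMap.id ℝ _ := by
    rw [← fderiv_comp x h2 h1, ← fderiv_id (𝕜 := ℝ) (x := x)]
    refine Filter.EventuallyEq.fderiv_eq ?_
    filter_upwards [hX.mem_nhds hx] with y hy
    exact hfg hy
  have hinj : Function.Injective (fderiv ℝ g x).toLinearMap := fun a b hab => by
    have := congrArg (fderiv ℝ f (g x)) hab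
    simpa using (DFunLike.congr_fun h3 a).symm.trans (this.trans (DFunLike.congr_fun h3 b))
  exact ⟨(LinearEquiv.ofInjectiveEndo _ hinj).toContinuousLinearEquiv, by ext; rfl⟩

end

section

variable {n : ℕ} {U : Type*} {X : Set (EuclideanSpace ℝ (Fin n))}
  {G : EuclideanSpace ℝ (Fin n) → U → EuclideanSpace ℝ (Fin n)}

theorem derivVariationLE_of_limsupQuotient_le {x : EuclideanSpace ℝ (Fin n)} {w : U} {L : ℝ}
    (hinv : (D₁ G x w).IsInvertible) (h : limsupQuotient G x w ≤ (L : EReal)) :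
    DerivVariationLE (fun y => G y w) x L := by
  intro c hc
  have h1 := eventually_lt_of_limsup_lt (h.trans_lt (EReal.coe_lt_coe_iff.2 hc))
  rw [eventually_nhdsWithin_iff] at h1
  have h2 : Tendsto (fun y => y - x) (𝓝 x) (𝓝 0) := by
    have : ContinuousAt (fun y => y - x) x := by fun_prop
    simpa [ContinuousAt] using this
  filter_upwards [h2.eventually h1] with y hy
  -- The punctured limit says nothing at `y = x`; there invertibility makes the variation vanish.
  rcases eq_or_ne y x with rfl | hyx
  · have h0 : (fderiv ℝ (fun y => G y w) y).inverse ∘L fderiv ℝ (fun y => G y w) y =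
        ContinuousLinearMap.id ℝ _ := hinv.inverse_comp_self
    rw [h0]
    simp
  · have h3 := EReal.coe_lt_coe_iff.1 (hy (by simpa [sub_eq_zero] using hyx))
    rw [add_sub_cancel, div_lt_iff₀ (norm_pos_iff.2 (sub_ne_zero.2 hyx))] at h3
    exact h3.le

theorem limsupQuotient_nonneg (hn : 1 ≤ n) (x : EuclideanSpace ℝ (Fin n)) (w : U) :
    0 ≤ limsupQuotient G x w := by
  have : Nontrivial (EuclideanSpace ℝ (Fin n)) := by
    have : Nonempty (Fin n) := ⟨⟨0, hn⟩⟩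
    infer_instance
  refine le_limsup_of_frequently_le (Eventually.frequently ?_)
  filter_upwards with h
  exact EReal.coe_nonneg.2 (by positivity)

theorem mapsTo_generalSolution (hG : ∀ w, IsC11DiffeoInto X (fun x => G x w)) (u : ℕ → U)
    (k : ℕ) : MapsTo (fun x => generalSolution G k x u) X X := by
  induction k with
  | zero => exact fun x hx => hx
  | succ k ih => exact (hG (u k)).mapsTo.comp ih

theorem injOn_generalSolution (hG : ∀ w, IsC11DiffeoInto X (fun x => G x w)) (u : ℕ → U)
    (k : ℕ) : InjOn (fun x => generalSolution G k x u) X := by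
  induction k with
  | zero => exact fun x _ y _ h => h
  | succ k ih => exact (hG (u k)).injOn.comp ih (mapsTo_generalSolution hG u k)

theorem contDiffOn_generalSolution (hG : ∀ w, IsC11DiffeoInto X (fun x => G x w)) (u : ℕ → U)
    (k : ℕ) : ContDiffOn ℝ 1 (fun x => generalSolution G k x u) X := by
  induction k with
  | zero => exact contDiffOn_id
  | succ k ih => exact (hG (u k)).contDiffOn.comp ih (mapsTo_generalSolution hG u k)

theorem fderiv_generalSolution_succ (hX : IsOpen X)
    (hG : ∀ w, IsC11DiffeoInto X (fun x => G x w)) (u : ℕ → U) (k : ℕ)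
    {x : EuclideanSpace ℝ (Fin n)} (hx : x ∈ X) :
    fderiv ℝ (fun x => generalSolution G (k + 1) x u) x =
      D₁ G (generalSolution G k x u) (u k) ∘L fderiv ℝ (fun x => generalSolution G k x u) x :=
  fderiv_fun_comp x (g := fun y => G y (u k)) (((hG (u k)).contDiffOn.contDiffAt
      (hX.mem_nhds (mapsTo_generalSolution hG u k hx))).differentiableAt one_ne_zero)
    (((contDiffOn_generalSolution hG u k).contDiffAt (hX.mem_nhds hx)).differentiableAt
      one_ne_zero)

theorem isInvertible_fderiv_generalSolution (hX : IsOpen X)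
    (hG : ∀ w, IsC11DiffeoInto X (fun x => G x w)) (u : ℕ → U) (k : ℕ)
    {x : EuclideanSpace ℝ (Fin n)} (hx : x ∈ X) :
    (fderiv ℝ (fun x => generalSolution G k x u) x).IsInvertible := by
  induction k with
  | zero =>
    have : fderiv ℝ (fun x => generalSolution G 0 x u) x = ContinuousLinearMap.id ℝ _ :=
      fderiv_id
    rw [this]
    exact ⟨ContinuousLinearEquiv.refl ℝ _, rfl⟩
  | succ k ih =>
    rw [fderiv_generalSolution_succ hX hG u k hx]
    exact ((hG (u k)).isInvertible_fderiv hX (mapsTo_generalSolution hG u k hx)).comp ih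

theorem norm_sq_mul_norm_inverse_comp_le {E : Type*} [NormedAddCommGroup E] [NormedSpace ℝ E]
    {A B : E →L[ℝ] E} (hB : B.IsInvertible) {a b : ℝ} (hb : ‖B‖ ^ 2 * ‖B.inverse‖ ≤ b)
    (ha : ‖A‖ ^ 2 * ‖A.inverse‖ ≤ a) :
    ‖B ∘L A‖ ^ 2 * ‖(B ∘L A).inverse‖ ≤ a * b := by
  rw [hB.inverse_comp_of_left]
  calc ‖B ∘L A‖ ^ 2 * ‖A.inverse ∘L B.inverse‖
      ≤ (‖B‖ * ‖A‖) ^ 2 * (‖A.inverse‖ * ‖B.inverse‖) := by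
        gcongr
        · exact B.opNorm_comp_le A
        · exact A.inverse.opNorm_comp_le B.inverse
    _ = (‖A‖ ^ 2 * ‖A.inverse‖) * (‖B‖ ^ 2 * ‖B.inverse‖) := by ring
    _ ≤ a * b := by
        have : 0 ≤ a := le_trans (by positivity) ha
        gcongr

/-- The estimates are proved together: the next map acts on the outside, so its bound `L₂` is
weighted by the distortion `L₁ ^ k` of the first `k` steps. -/
theorem generalSolution_estimates (hn : 1 ≤ n) (hX : IsOpen X)
    (hG : ∀ w, IsC11DiffeoInto X (fun x => G x w)) (u : ℕ → U)
    {L₁ L₂ : ℝ} (hL₁0 : 0 ≤ L₁) (hL₂0 : 0 ≤ L₂) {x : EuclideanSpace ℝ (Fin n)} (hx : x ∈ X)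
    (k : ℕ)
    (hL₁ : ∀ j < k, maxSingularValue (D₁ G (generalSolution G j x u) (u j)) ^ 2 /
      minSingularValue (D₁ G (generalSolution G j x u) (u j)) ≤ L₁)
    (hL₂ : ∀ j < k, limsupQuotient G (generalSolution G j x u) (u j) ≤ (L₂ : EReal)) :
    ‖fderiv ℝ (fun x => generalSolution G k x u) x‖ ^ 2 *
        ‖(fderiv ℝ (fun x => generalSolution G k x u) x).inverse‖ ≤ L₁ ^ k ∧
      DerivVariationLE (fun x => generalSolution G k x u) x
        (L₂ * ∑ τ ∈ Finset.range k, L₁ ^ τ) := by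
  induction k with
  | zero =>
    have h0 : fderiv ℝ (fun x => generalSolution G 0 x u) x = ContinuousLinearMap.id ℝ _ :=
      fderiv_id
    constructor
    · rw [h0, ContinuousLinearMap.inverse_id, pow_zero]
      have := ContinuousLinearMap.norm_id_le (𝕜 := ℝ) (E := EuclideanSpace ℝ (Fin n))
      exact mul_le_one₀ (pow_le_one₀ (norm_nonneg _) this) (norm_nonneg _) this
    · rw [Finset.sum_range_zero, mul_zero]
      exact derivVariationLE_id x
  | succ k ih =>
    obtain ⟨ih1, ih2⟩ := ih (fun j hj => hL₁ j (hj.trans k.lt_succ_self))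
      (fun j hj => hL₂ j (hj.trans k.lt_succ_self))
    have hxk := mapsTo_generalSolution hG u k hx
    have hB := (hG (u k)).isInvertible_fderiv hX hxk
    constructor
    · rw [fderiv_generalSolution_succ hX hG u k hx, pow_succ]
      exact norm_sq_mul_norm_inverse_comp_le hB
        ((norm_sq_mul_norm_inverse_le hn hB).trans (hL₁ k k.lt_succ_self)) ih1
    · have hvar := derivVariationLE_of_limsupQuotient_le hB (hL₂ k k.lt_succ_self)
      refine (ih2.comp (f := fun y => G y (u k)) (by positivity) hL₂0 hvar ?_ ?_
        (isInvertible_fderiv_generalSolution hX hG u k hx) hB).mono ?_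
      · filter_upwards [hX.mem_nhds hx] with y hy
        exact ((contDiffOn_generalSolution hG u k).contDiffAt
          (hX.mem_nhds hy)).differentiableAt one_ne_zero
      · filter_upwards [hX.mem_nhds hxk] with y hy
        exact ((hG (u k)).contDiffOn.contDiffAt (hX.mem_nhds hy)).differentiableAt one_ne_zero
      · rw [Finset.sum_range_succ, mul_add]
        gcongr

end

theorem mainTheorem2 {n : ℕ} (hn : 2 ≤ n) {U : Type*}
    (X : Set (EuclideanSpace ℝ (Fin n))) (hX : IsOpen X)
    (G : EuclideanSpace ℝ (Fin n) → U → EuclideanSpace ℝ (Fin n))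
    (hG : ∀ w : U, IsC11DiffeoInto X (fun x => G x w))
    (N : ℕ) (hN : 1 ≤ N)
    (r : ℝ) (Ω : Set (EuclideanSpace ℝ (Fin n))) (hΩX : Ω ⊆ X)
    (hΩ : IsRConvex r Ω) (hΩne : Ω ≠ univ)
    (L₁ L₂ : ℝ)
    (hL₁ : ∀ x ∈ reachableSet G N Ω, ∀ w : U,
      maxSingularValue (D₁ G x w) ^ 2 / minSingularValue (D₁ G x w) ≤ L₁)
    (hL₂ : ∀ x ∈ reachableSet G N Ω, ∀ w : U, limsupQuotient G x w ≤ (L₂ : EReal))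
    (hr : r * L₂ * ∑ τ ∈ Finset.range N, L₁ ^ τ ≤ 1) :
    ∀ k ≤ N, ∀ u : ℕ → U, Convex ℝ (attainableSet G k Ω u) := by
  intro k hk u
  rcases Ω.eq_empty_or_nonempty with rfl | ⟨x₀, hx₀⟩
  · simp [attainableSet, convex_empty]
  have hreach : ∀ x ∈ Ω, ∀ j < N, generalSolution G j x u ∈ reachableSet G N Ω :=
    fun x hx j hj => ⟨j, hj, u, mem_image_of_mem _ hx⟩
  -- Both signs come from the hypotheses at time `0`, which counts as reachable because `N ≥ 1`.
  have hL₁0 : 0 ≤ L₁ := le_trans (div_nonneg (sq_nonneg _)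
    (LinearMap.singularValues_nonneg _ _)) (hL₁ _ (hreach x₀ hx₀ 0 hN) (u 0))
  have hL₂0 : 0 ≤ L₂ := EReal.coe_nonneg.1 ((limsupQuotient_nonneg (by omega) _ _).trans
    (hL₂ _ (hreach x₀ hx₀ 0 hN) (u 0)))
  have : Nontrivial (EuclideanSpace ℝ (Fin n)) := by
    have : Nonempty (Fin n) := ⟨⟨0, by omega⟩⟩
    infer_instance
  obtain ⟨hr0, M, rfl⟩ := hΩ
  -- An empty family of balls would intersect in the whole space.
  have hM : M.Nonempty := by
    rw [nonempty_iff_ne_empty]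
    rintro rfl
    simp at hΩne
  refine convex_image_iInter_closedBall (C := L₂ * ∑ τ ∈ Finset.range k, L₁ ^ τ) hr0
    (by positivity) ?_ hM hX hΩX (injOn_generalSolution hG u k)
    (contDiffOn_generalSolution hG u k)
    (fun x hx => isInvertible_fderiv_generalSolution hX hG u k hx) fun x hx => ?_
  · rw [← mul_assoc]
    refine le_trans ?_ hr
    gcongr
  · exact (generalSolution_estimates (by omega) hX hG u hL₁0 hL₂0 (hΩX hx) k
      (fun j hj => hL₁ _ (hreach x hx j (hj.trans_le hk)) _)
      (fun j hj => hL₂ _ (hreach x hx j (hj.trans_le hk)) _)).2
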